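/- For an integer $n\ge 1$ let $$\mathcal L_n=\{(x_1,\dots,x_n)\in\mathbf R^n : x_n\ge (x_1^2+\dots+x_{n-1}^2)^{1/2}\}$$ be the $n$-dimensional Lorentz cone, with interior $\mathrm{int}(\mathcal L_n)$ (for $n=1$, $\mathcal L_1=[0,\infty)$). A linear map $\Psi:\mathbf R^n\to\mathbf R^n$ is called positive if $\Psi(\mathcal L_n)\subset\mathcal L_n$, strictly positive if $\Psi(\mathcal L_n\setminus\{0\})\subset\mathrm{int}(\mathcal L_n)$, and primitive if it is positive and $\Psi^k$ is strictly positive for some integer $k\ge 1$; in that case the smallest such $k$ is called the primitivity index of $\Psi$ and is denoted $\gamma(\Psi)$. The maximal exponent $\gamma(\mathcal L_n)$ is the supremum of $\gamma(\Psi)$ over all primitive linear maps $\Psi:\mathbf R^n\to\mathbf R^n$. Let $n\ge 1$. If $\Psi:\mathbf R^n\to\mathbf R^n$ is a primitive linear map, then $\gamma(\Psi)\le n$. Moreover, there is a primitive linear map $\Psi:\mathbf R^n\to\mathbf R^n$ such that $\gamma(\Psi)=n$. In other words, $\gamma(\mathcal L_n)=n$. -/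

import Mathlib

/-- The `n`-dimensional Lorentz cone (`n ≥ 1`):
`{(x₁, …, xₙ) ∈ ℝⁿ : xₙ ≥ (x₁² + ⋯ + xₙ₋₁²)^(1/2)}`, with coordinates indexed from `0` to `n - 1`. -/
def lorentzCone (n : ℕ) (hn : 1 ≤ n) : Set (EuclideanSpace ℝ (Fin n)) :=
  {x | Real.sqrt (∑ i : Fin (n - 1), x ⟨(i : ℕ), by omega⟩ ^ 2) ≤ x ⟨n - 1, by omega⟩}

section Cone

variable {V : Type*} [AddCommGroup V] [Module ℝ V]

/-- `Ψ` is `C`-positive: `Ψ(C) ⊆ C`. -/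
def IsPositiveMap (C : Set V) (Ψ : V →ₗ[ℝ] V) : Prop :=
  Set.MapsTo Ψ C C

/-- `Ψ` is strictly `C`-positive: `Ψ(C \ {0}) ⊆ int C`. -/
def IsStrictlyPositiveMap [TopologicalSpace V] (C : Set V) (Ψ : V →ₗ[ℝ] V) : Prop :=
  Set.MapsTo Ψ (C \ {0}) (interior C)

/-- `Ψ` is `C`-primitive: it is `C`-positive and some power `Ψ ^ k` with `k ≥ 1` is strictly
`C`-positive (powers are for composition). -/
def IsPrimitiveMap [TopologicalSpace V] (C : Set V) (Ψ : V →ₗ[ℝ] V) : Prop :=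
  IsPositiveMap C Ψ ∧ ∃ k : ℕ, 1 ≤ k ∧ IsStrictlyPositiveMap C (Ψ ^ k)

/-- The `C`-primitivity index `γ(C, Ψ)`: the smallest `k ≥ 1` such that `Ψ ^ k` is strictly
`C`-positive. Only meaningful when `Ψ` is `C`-primitive. -/
noncomputable def primitivityIndex [TopologicalSpace V] (C : Set V) (Ψ : V →ₗ[ℝ] V) : ℕ :=
  sInf {k : ℕ | 1 ≤ k ∧ IsStrictlyPositiveMap C (Ψ ^ k)}

/-- The maximal exponent `γ(C)`: the supremum (possibly infinite) of `γ(C, Ψ)` over all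
`C`-primitive linear maps `Ψ : V → V`. -/
noncomputable def maximalExponent [TopologicalSpace V] (C : Set V) : ℕ∞ :=
  ⨆ (Ψ : V →ₗ[ℝ] V) (_ : IsPrimitiveMap C Ψ), (primitivityIndex C Ψ : ℕ∞)

end Cone

/-!
Membership in the Lorentz cone and in its interior is decided by the Lorentz form
`q = x_l² - ∑_{i ≠ l} x_i²` and the sign of the time coordinate `x_l`.

*Upper bound.* If `Ψ` preserves the cone then `q x ≥ 0` implies `q (Ψ x) ≥ 0`, so by the S-lemma
(`exists_mul_le_of_nonneg_imp_nonneg`) there is a constant `c` for which `Q x = q (Ψ x) - c * q x`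
is positive semidefinite. Let `Ψ` be primitive and suppose that `Ψ ^ n` maps some nonzero `x` of the
cone to the boundary. A primitive map preserves the interior (`IsPrimitiveMap.map_mem_interior`), so
`x, Ψ x, …, Ψ ^ n x` are all null. Hence `Q` vanishes at `x, …, Ψ ^ (n - 1) x`, that is, these
vectors lie in the linear subspace `ker Q`. By Cayley–Hamilton
(`pow_apply_mem_of_forall_lt_finrank`) the whole orbit of `x` lies in `ker Q`, so
`q (Ψ ^ (k + 1) x) = c * q (Ψ ^ k x)` for all `k`, and the whole orbit is null. This contradicts
primitivity.

*Sharpness.* For `n = m + 1 ≥ 2` the form `(∑ aᵢ)² - ∑ aᵢ²` is isometric to `q`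
(`exists_linearEquiv_lorentzForm_eq`), and its basis vectors `e₀, …, eₘ` are null. The map sending
`e₀ ↦ e₁ ↦ ⋯ ↦ eₘ ↦ (e₀ + ⋯ + eₘ) / m` increases the form by a positive multiple of `aₘ²`
(`simplexForm_shiftMap`). The coordinate `aₘ` cannot vanish along `n` consecutive points of a
nonzero orbit, so the `n`-th power is strictly positive, while `e₀, …, eₘ` is an orbit of `n` null
vectors, so no smaller power is.
-/

/-! ### Quadratic forms nonnegative on a cone -/

/-- The homogeneous S-lemma: a quadratic form that is nonnegative wherever `B` is nonnegative
dominates a multiple of `B`. -/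
theorem exists_mul_le_of_nonneg_imp_nonneg {V : Type*} [AddCommGroup V] [Module ℝ V]
    {B P : LinearMap.BilinForm ℝ V} (hB : B.IsSymm) (hP : P.IsSymm)
    (h : ∀ x, 0 ≤ B x x → 0 ≤ P x x) {e : V} (he : 0 < B e e) :
    ∃ c : ℝ, ∀ x, c * B x x ≤ P x x := by
  -- Evaluate `P` at the two points where the line `v + t u` meets the null cone of `B`; a positive
  -- combination of these values is a multiple of `P v v * -B u u + P u u * B v v`.
  have key : ∀ u v, B u u < 0 → 0 < B v v → P u u / B u u ≤ P v v / B v v := by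
    intro u v hu hv
    have line : ∀ t : ℝ, B v v + 2 * t * B v u + t ^ 2 * B u u = 0 →
        0 ≤ P v v + 2 * t * P v u + t ^ 2 * P u u := by
      intro t ht
      have h1 := h (v + t • u) (by
        simp only [map_add, map_smul, LinearMap.add_apply, LinearMap.smul_apply, smul_eq_mul,
          hB.eq u v]
        linarith)
      simp only [map_add, map_smul, LinearMap.add_apply, LinearMap.smul_apply, smul_eq_mul,
          hP.eq u v] at h1
      linarith
    set α := B v v
    set γ := B u u
    set b := B v u
    set r := √(b ^ 2 - α * γ)
    have hr : r ^ 2 = b ^ 2 - α * γ := Real.sq_sqrt (by nlinarith)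
    have hbr : |b| < r := Real.lt_sqrt_of_sq_lt (by rw [sq_abs]; nlinarith)
    obtain ⟨hb1, hb2⟩ := abs_lt.1 hbr
    have hγ : γ ≠ 0 := hu.ne
    have h1 := line ((-b - r) / γ) (by field_simp; linear_combination hr)
    have h2 := line ((-b + r) / γ) (by field_simp; linear_combination hr)
    have e1 : γ ^ 2 * ((r - b) * (P v v + 2 * ((-b - r) / γ) * P v u + ((-b - r) / γ) ^ 2 * P u u)
        + (r + b) * (P v v + 2 * ((-b + r) / γ) * P v u + ((-b + r) / γ) ^ 2 * P u u))
        = 2 * r * (-γ) * (P u u * α - P v v * γ) := by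
      field_simp
      linear_combination (2 * r * P u u) * hr
    have h3 : 0 ≤ 2 * r * (-γ) * (P u u * α - P v v * γ) := by
      rw [← e1]
      have : 0 ≤ r - b := by linarith
      have : 0 ≤ r + b := by linarith
      positivity
    have h4 : 0 < 2 * r * (-γ) := mul_pos (by linarith) (by linarith)
    have h5 := nonneg_of_mul_nonneg_right h3 h4
    rw [div_le_iff_of_neg hu, div_mul_eq_mul_div, div_le_iff₀ hv]
    linarith
  let S : Set ℝ := (fun v => P v v / B v v) '' {v | 0 < B v v}
  have hS : BddBelow S := ⟨0, by
    rintro _ ⟨v, hv, rfl⟩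
    exact div_nonneg (h v (le_of_lt hv)) (le_of_lt hv)⟩
  refine ⟨sInf S, fun x => ?_⟩
  rcases lt_trichotomy (B x x) 0 with hx | hx | hx
  · rw [← div_le_iff_of_neg hx]
    refine le_csInf ⟨_, e, he, rfl⟩ ?_
    rintro _ ⟨v, hv, rfl⟩
    exact key x v hx hv
  · simpa [hx] using h x hx.ge
  · rw [← le_div_iff₀ hx]
    exact csInf_le hS ⟨x, hx, rfl⟩

/-- By Cayley–Hamilton, an orbit whose first `dim V` points lie in a subspace stays in it. -/
theorem pow_apply_mem_of_forall_lt_finrank {K V : Type*} [Field K] [AddCommGroup V] [Module K V]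
    [FiniteDimensional K V] (f : Module.End K V) (W : Submodule K V) (x : V)
    (h : ∀ i < Module.finrank K V, (f ^ i) x ∈ W) (k : ℕ) : (f ^ k) x ∈ W := by
  rcases subsingleton_or_nontrivial V with hV | hV
  · rw [Subsingleton.elim ((f ^ k) x) 0]
    exact W.zero_mem
  have hd : (Polynomial.X ^ k %ₘ f.charpoly).natDegree < Module.finrank K V := by
    rw [← LinearMap.charpoly_natDegree f]
    refine Polynomial.natDegree_modByMonic_lt _ f.charpoly_monic fun h1 => ?_
    have := LinearMap.charpoly_natDegree f
    rw [h1, Polynomial.natDegree_one] at this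
    exact Module.finrank_pos.ne this
  rw [LinearMap.pow_eq_aeval_mod_charpoly, Polynomial.aeval_eq_sum_range' hd, LinearMap.sum_apply]
  exact W.sum_mem fun i hi => W.smul_mem _ (h i (Finset.mem_range.1 hi))

theorem exists_pos_sub_smul_mem_of_mem_interior {V : Type*} [NormedAddCommGroup V]
    [NormedSpace ℝ V] {C : Set V} {y : V} (hy : y ∈ interior C) (x : V) :
    ∃ t : ℝ, 0 < t ∧ y - t • x ∈ C := by
  have hc : Continuous fun t : ℝ => y - t • x := by fun_prop
  have h0 : ∀ᶠ t in nhds (0 : ℝ), y - t • x ∈ C :=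
    hc.continuousAt.eventually (by simpa using mem_interior_iff_mem_nhds.1 hy)
  exact (((h0.filter_mono nhdsWithin_le_nhds).and
    (self_mem_nhdsWithin : Set.Ioi (0 : ℝ) ∈ nhdsWithin 0 (Set.Ioi 0))).exists).imp
      fun t ht => ⟨ht.2, ht.1⟩

/-! ### The Lorentz form and the Lorentz cone -/

/-- The Lorentz form `⟪x, y⟫ = x_l y_l - ∑_{i ≠ l} x_i y_i` on `ℝⁿ` with time coordinate `l`, written
in terms of the Euclidean inner product. -/
noncomputable def lorentzForm {n : ℕ} (l : Fin n) :
    LinearMap.BilinForm ℝ (EuclideanSpace ℝ (Fin n)) :=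
  LinearMap.mk₂ ℝ (fun x y => 2 * x l * y l - inner ℝ x y)
    (fun x y z => by simp only [PiLp.add_apply, inner_add_left]; ring)
    (fun c x y => by simp only [PiLp.smul_apply, smul_eq_mul, real_inner_smul_left]; ring)
    (fun x y z => by simp only [PiLp.add_apply, inner_add_right]; ring)
    (fun c x y => by simp only [PiLp.smul_apply, smul_eq_mul, real_inner_smul_right]; ring)

section LorentzForm

variable {n : ℕ}

theorem lorentzForm_apply (l : Fin n) (x y : EuclideanSpace ℝ (Fin n)) :
    lorentzForm l x y = 2 * x l * y l - inner ℝ x y := rfl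

theorem lorentzForm_self (l : Fin n) (x : EuclideanSpace ℝ (Fin n)) :
    lorentzForm l x x = 2 * x l ^ 2 - ‖x‖ ^ 2 := by
  rw [lorentzForm_apply, real_inner_self_eq_norm_sq]
  ring

theorem lorentzForm_isSymm (l : Fin n) : (lorentzForm l).IsSymm :=
  ⟨fun x y => by rw [lorentzForm_apply, lorentzForm_apply, real_inner_comm]; ring⟩

/-- Two vectors in the same closed nappe of the light cone have nonnegative Lorentz product. -/
theorem lorentzForm_nonneg (l : Fin n) {x y : EuclideanSpace ℝ (Fin n)} (hxl : 0 ≤ x l)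
    (hx : 0 ≤ lorentzForm l x x) (hyl : 0 ≤ y l) (hy : 0 ≤ lorentzForm l y y) :
    0 ≤ lorentzForm l x y := by
  rw [lorentzForm_self] at hx hy
  rw [lorentzForm_apply]
  have h1 : (‖x‖ * ‖y‖) ^ 2 ≤ (2 * x l * y l) ^ 2 := by
    calc (‖x‖ * ‖y‖) ^ 2 = ‖x‖ ^ 2 * ‖y‖ ^ 2 := by ring
      _ ≤ (2 * x l ^ 2) * (2 * y l ^ 2) :=
        mul_le_mul (by linarith) (by linarith) (by positivity) (by positivity)
      _ = _ := by ring
  have h2 := abs_le_of_sq_le_sq' h1 (by positivity)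
  linarith [real_inner_le_norm x y, h2.2]

theorem norm_sq_eq_sum_add_last (hn : 1 ≤ n) (x : EuclideanSpace ℝ (Fin n)) :
    ‖x‖ ^ 2 = ∑ i : Fin (n - 1), x ⟨(i : ℕ), by omega⟩ ^ 2 + x ⟨n - 1, by omega⟩ ^ 2 := by
  obtain ⟨m, rfl⟩ : ∃ m, n = m + 1 := ⟨n - 1, by omega⟩
  rw [EuclideanSpace.real_norm_sq_eq, Fin.sum_univ_castSucc]
  rfl

theorem mem_lorentzCone_iff (hn : 1 ≤ n) (x : EuclideanSpace ℝ (Fin n)) :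
    x ∈ lorentzCone n hn ↔
      0 ≤ x ⟨n - 1, by omega⟩ ∧ 0 ≤ lorentzForm ⟨n - 1, by omega⟩ x x := by
  rw [lorentzForm_self, norm_sq_eq_sum_add_last hn, lorentzCone, Set.mem_ofPred_eq,
    Real.sqrt_le_iff]
  exact and_congr_right fun _ => ⟨fun h => by linarith, fun h => by linarith⟩

theorem lorentzForm_single_right (l : Fin n) (x : EuclideanSpace ℝ (Fin n)) :
    lorentzForm l x (EuclideanSpace.single l 1) = x l := by
  rw [lorentzForm_apply, EuclideanSpace.inner_single_right]
  simp
  ring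

theorem single_mem_lorentzCone (hn : 1 ≤ n) :
    EuclideanSpace.single ⟨n - 1, by omega⟩ 1 ∈ lorentzCone n hn := by
  rw [mem_lorentzCone_iff, lorentzForm_single_right]
  simp

theorem mem_interior_lorentzCone_iff (hn : 1 ≤ n) (x : EuclideanSpace ℝ (Fin n)) :
    x ∈ interior (lorentzCone n hn) ↔
      x ∈ lorentzCone n hn ∧ 0 < lorentzForm ⟨n - 1, by omega⟩ x x := by
  set l : Fin n := ⟨n - 1, by omega⟩
  constructor
  · intro hx
    refine ⟨interior_subset hx, ?_⟩
    obtain ⟨t, ht0, ht⟩ := exists_pos_sub_smul_mem_of_mem_interior hx (EuclideanSpace.single l 1)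
    obtain ⟨h1, h2⟩ := (mem_lorentzCone_iff hn _).1 ht
    change 0 ≤ (x - t • EuclideanSpace.single l (1 : ℝ)) l at h1
    change 0 ≤ lorentzForm l _ _ at h2
    simp only [map_sub, map_smul, LinearMap.sub_apply, LinearMap.smul_apply, smul_eq_mul,
      lorentzForm_single_right, (lorentzForm_isSymm l).eq (EuclideanSpace.single l 1) x] at h2
    simp only [PiLp.sub_apply, PiLp.smul_apply, PiLp.single_apply, if_true, smul_eq_mul,
      mul_one] at h1 h2
    nlinarith
  · rintro ⟨hx, hq⟩
    have h1 : Continuous fun y : EuclideanSpace ℝ (Fin n) => y l := by fun_prop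
    have h2 : Continuous fun y : EuclideanSpace ℝ (Fin n) => 2 * y l ^ 2 - ‖y‖ ^ 2 := by fun_prop
    have ho : IsOpen {y : EuclideanSpace ℝ (Fin n) | 0 < y l ∧ 0 < 2 * y l ^ 2 - ‖y‖ ^ 2} :=
      (isOpen_lt continuous_const h1).inter (isOpen_lt continuous_const h2)
    refine mem_interior.2 ⟨_, fun y hy => ?_, ho, ?_, ?_⟩
    · exact (mem_lorentzCone_iff hn y).2 ⟨hy.1.le, by rw [lorentzForm_self]; exact hy.2.le⟩
    · refine lt_of_le_of_ne ((mem_lorentzCone_iff hn x).1 hx).1 fun h => ?_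
      rw [lorentzForm_self] at hq
      change 0 = x l at h
      rw [← h] at hq
      nlinarith [sq_nonneg ‖x‖]
    · rwa [lorentzForm_self] at hq

end LorentzForm

/-! ### The upper bound -/

theorem IsPositiveMap.pow {V : Type*} [AddCommGroup V] [Module ℝ V] {C : Set V} {Ψ : V →ₗ[ℝ] V}
    (h : IsPositiveMap C Ψ) (k : ℕ) : IsPositiveMap C (Ψ ^ k) := by
  rw [IsPositiveMap, Module.End.coe_pow]
  exact Set.MapsTo.iterate h k

section UpperBound

variable {n : ℕ}

theorem lorentzForm_map_nonneg {hn : 1 ≤ n}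
    {Ψ : EuclideanSpace ℝ (Fin n) →ₗ[ℝ] EuclideanSpace ℝ (Fin n)}
    (hΨ : IsPositiveMap (lorentzCone n hn) Ψ) {x : EuclideanSpace ℝ (Fin n)}
    (hx : 0 ≤ lorentzForm ⟨n - 1, by omega⟩ x x) :
    0 ≤ lorentzForm ⟨n - 1, by omega⟩ (Ψ x) (Ψ x) := by
  rcases le_total 0 (x ⟨n - 1, by omega⟩) with h | h
  · exact ((mem_lorentzCone_iff hn _).1 (hΨ ((mem_lorentzCone_iff hn x).2 ⟨h, hx⟩))).2
  · have h1 := ((mem_lorentzCone_iff hn _).1 (hΨ ((mem_lorentzCone_iff hn (-x)).2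
      ⟨by simpa using h, by simpa using hx⟩))).2
    simpa using h1

/-- A primitive map preserves the interior of the cone: if some interior point were mapped to the
boundary, then superadditivity of the Lorentz form on the cone would force the whole cone to be
mapped to the boundary. -/
theorem IsPrimitiveMap.map_mem_interior {hn : 1 ≤ n}
    {Ψ : EuclideanSpace ℝ (Fin n) →ₗ[ℝ] EuclideanSpace ℝ (Fin n)}
    (hΨ : IsPrimitiveMap (lorentzCone n hn) Ψ) {y : EuclideanSpace ℝ (Fin n)}
    (hy : y ∈ interior (lorentzCone n hn)) : Ψ y ∈ interior (lorentzCone n hn) := by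
  obtain ⟨hpos, k, hk, hs⟩ := hΨ
  set l : Fin n := ⟨n - 1, by omega⟩ with hl
  refine (mem_interior_lorentzCone_iff hn _).2 ⟨hpos (interior_subset hy), ?_⟩
  by_contra! hnull
  have hall : ∀ x ∈ lorentzCone n hn, lorentzForm l (Ψ x) (Ψ x) ≤ 0 := by
    intro x hx
    obtain ⟨t, ht0, ht⟩ := exists_pos_sub_smul_mem_of_mem_interior hy x
    obtain ⟨a1, a2⟩ := (mem_lorentzCone_iff hn _).1 (hpos ht)
    obtain ⟨b1, b2⟩ := (mem_lorentzCone_iff hn _).1 (hpos hx)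
    have hab := lorentzForm_nonneg l a1 a2 b1 b2
    rw [← hl] at a2 b2
    have he : Ψ y = Ψ (y - t • x) + t • Ψ x := by simp
    have h2 : lorentzForm l (Ψ y) (Ψ y) = lorentzForm l (Ψ (y - t • x)) (Ψ (y - t • x))
        + 2 * t * lorentzForm l (Ψ (y - t • x)) (Ψ x) + t ^ 2 * lorentzForm l (Ψ x) (Ψ x) := by
      rw [he, map_add (lorentzForm l), LinearMap.add_apply, map_add, map_add,
        (lorentzForm_isSymm l).eq (t • Ψ x) (Ψ (y - t • x))]
      simp only [map_smul, LinearMap.smul_apply, smul_eq_mul]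
      ring
    by_contra! hb
    have : 0 < t ^ 2 * lorentzForm l (Ψ x) (Ψ x) := by positivity
    have : 0 ≤ 2 * t * lorentzForm l (Ψ (y - t • x)) (Ψ x) := by positivity
    linarith
  obtain ⟨j, rfl⟩ : ∃ j, k = j + 1 := ⟨k - 1, by omega⟩
  have h1 := hs ⟨single_mem_lorentzCone hn, by simp⟩
  rw [pow_succ', Module.End.mul_apply, mem_interior_lorentzCone_iff] at h1
  exact absurd h1.2 (not_lt.2 (hall _ (hpos.pow j (single_mem_lorentzCone hn))))

theorem IsPrimitiveMap.isStrictlyPositiveMap_pow {hn : 1 ≤ n}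
    {Ψ : EuclideanSpace ℝ (Fin n) →ₗ[ℝ] EuclideanSpace ℝ (Fin n)}
    (hΨ : IsPrimitiveMap (lorentzCone n hn) Ψ) :
    IsStrictlyPositiveMap (lorentzCone n hn) (Ψ ^ n) := by
  rintro x ⟨hx, hx0⟩
  set l : Fin n := ⟨n - 1, by omega⟩ with hl
  by_contra hnot
  have hmem : ∀ i, (Ψ ^ i) x ∈ lorentzCone n hn := fun i => hΨ.1.pow i hx
  have hnull : ∀ i ≤ n, lorentzForm l ((Ψ ^ i) x) ((Ψ ^ i) x) = 0 := by
    intro i hi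
    refine le_antisymm ?_ ((mem_lorentzCone_iff hn _).1 (hmem i)).2
    by_contra! hlt
    apply hnot
    obtain ⟨j, rfl⟩ := Nat.exists_eq_add_of_le' hi
    rw [pow_add, Module.End.mul_apply, Module.End.coe_pow]
    exact Set.MapsTo.iterate (fun y hy => hΨ.map_mem_interior hy) j
      ((mem_interior_lorentzCone_iff hn _).2 ⟨hmem i, hlt⟩)
  have hsymm := lorentzForm_isSymm l
  let P : LinearMap.BilinForm ℝ (EuclideanSpace ℝ (Fin n)) := (lorentzForm l).compl₁₂ Ψ Ψ
  have hP : ∀ y z, P y z = lorentzForm l (Ψ y) (Ψ z) := fun _ _ => rfl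
  have hPsymm : P.IsSymm := ⟨fun y z => hsymm.eq _ _⟩
  obtain ⟨c, hc⟩ := exists_mul_le_of_nonneg_imp_nonneg hsymm hPsymm
    (fun y hy => lorentzForm_map_nonneg hΨ.1 hy) (e := EuclideanSpace.single l 1)
    (by rw [lorentzForm_single_right]; simp)
  -- The positive semidefinite defect of `Ψ` from being a similarity of the Lorentz form.
  let Q : LinearMap.BilinForm ℝ (EuclideanSpace ℝ (Fin n)) := P - c • lorentzForm l
  have hQ : ∀ y, Q y y = lorentzForm l (Ψ y) (Ψ y) - c * lorentzForm l y y := fun _ => rfl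
  have hQ0 : ∀ y, 0 ≤ Q y y := fun y => by
    rw [hQ]
    linarith [hc y, hP y y]
  have hQsymm : LinearMap.IsSymm Q := LinearMap.BilinForm.isSymm_iff.1
    ⟨fun y z => by
      change P y z - c * lorentzForm l y z = P z y - c * lorentzForm l z y
      rw [hPsymm.eq z y, hsymm.eq z y]⟩
  have hker := pow_apply_mem_of_forall_lt_finrank Ψ (LinearMap.ker Q) x (fun i hi => by
    rw [finrank_euclideanSpace_fin] at hi
    rw [← Q.apply_apply_same_eq_zero_iff hQ0 hQsymm, hQ, hnull i hi.le, ← Module.End.mul_apply,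
      ← pow_succ', hnull (i + 1) hi]
    ring)
  have hall : ∀ i, lorentzForm l ((Ψ ^ i) x) ((Ψ ^ i) x) = 0 := by
    intro i
    induction i with
    | zero => exact hnull 0 (Nat.zero_le n)
    | succ i ih =>
      have h1 := (Q.apply_apply_same_eq_zero_iff hQ0 hQsymm).2 (hker i)
      rw [hQ, ih, ← Module.End.mul_apply, ← pow_succ'] at h1
      linarith
  obtain ⟨-, k, -, hs⟩ := hΨ
  exact ((mem_interior_lorentzCone_iff hn _).1 (hs ⟨hx, hx0⟩)).2.ne' (hall k)

theorem primitivityIndex_le {hn : 1 ≤ n}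
    {Ψ : EuclideanSpace ℝ (Fin n) →ₗ[ℝ] EuclideanSpace ℝ (Fin n)}
    (hΨ : IsPrimitiveMap (lorentzCone n hn) Ψ) : primitivityIndex (lorentzCone n hn) Ψ ≤ n :=
  Nat.sInf_le ⟨hn, hΨ.isStrictlyPositiveMap_pow⟩

end UpperBound

/-! ### A map with extremal primitivity index -/

/-- The linear map on `ℝᵐ⁺¹` with `e₀ ↦ e₁ ↦ ⋯ ↦ eₘ ↦ (e₀ + ⋯ + eₘ) / m`. -/
noncomputable def shiftMap (m : ℕ) : (Fin (m + 1) → ℝ) →ₗ[ℝ] (Fin (m + 1) → ℝ) where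
  toFun a := fun i => (Fin.cons 0 fun j : Fin m => a j.castSucc : Fin (m + 1) → ℝ) i
    + a (Fin.last m) / m
  map_add' a b := by
    ext i
    refine Fin.cases ?_ (fun j => ?_) i <;> simp <;> ring
  map_smul' c a := by
    ext i
    refine Fin.cases ?_ (fun j => ?_) i <;> simp <;> ring

/-- The quadratic form `(∑ aᵢ)² - ∑ aᵢ²` on `ℝᵐ⁺¹`. For `m ≥ 1` it has Lorentzian signature;
the basis vectors `eᵢ` are null with all mutual products equal to `1`. -/
def simplexForm {m : ℕ} (a : Fin (m + 1) → ℝ) : ℝ :=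
  (∑ i, a i) ^ 2 - ∑ i, a i ^ 2

section Extremal

variable {m : ℕ}

@[simp] theorem shiftMap_apply_zero (a : Fin (m + 1) → ℝ) :
    shiftMap m a 0 = a (Fin.last m) / m := by
  simp [shiftMap]

@[simp] theorem shiftMap_apply_succ (a : Fin (m + 1) → ℝ) (j : Fin m) :
    shiftMap m a j.succ = a j.castSucc + a (Fin.last m) / m := by
  simp [shiftMap]

theorem sum_shiftMap (hm : 1 ≤ m) (a : Fin (m + 1) → ℝ) :
    ∑ i, shiftMap m a i = ∑ i, a i + a (Fin.last m) / m := by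
  have hm0 : (m : ℝ) ≠ 0 := by positivity
  rw [Fin.sum_univ_succ, Fin.sum_univ_castSucc a]
  simp only [shiftMap_apply_zero, shiftMap_apply_succ, Finset.sum_add_distrib, Finset.sum_const,
    Finset.card_univ, Fintype.card_fin, nsmul_eq_mul]
  field_simp
  ring

/-- The pullback of the form along `shiftMap` exceeds the form by a rank-one square. -/
theorem simplexForm_shiftMap (hm : 1 ≤ m) (a : Fin (m + 1) → ℝ) :
    simplexForm (shiftMap m a) = simplexForm a + (m + 1) / m * a (Fin.last m) ^ 2 := by
  have hm0 : (m : ℝ) ≠ 0 := by positivity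
  rw [simplexForm, simplexForm, sum_shiftMap hm, Fin.sum_univ_succ fun i => shiftMap m a i ^ 2,
    Fin.sum_univ_castSucc a, Fin.sum_univ_castSucc fun i => a i ^ 2]
  simp only [shiftMap_apply_zero, shiftMap_apply_succ, add_sq, Finset.sum_add_distrib,
    Finset.sum_const, Finset.card_univ, Fintype.card_fin, nsmul_eq_mul, ← Finset.sum_mul,
    ← Finset.mul_sum]
  field_simp
  ring

theorem simplexForm_le_shiftMap_pow (hm : 1 ≤ m) (a : Fin (m + 1) → ℝ) (j : ℕ) :
    simplexForm a ≤ simplexForm ((shiftMap m ^ j) a) := by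
  induction j with
  | zero => exact le_rfl
  | succ j ih =>
    rw [pow_succ', Module.End.mul_apply, simplexForm_shiftMap hm]
    have : 0 ≤ ((m : ℝ) + 1) / m * (shiftMap m ^ j) a (Fin.last m) ^ 2 := by positivity
    linarith

theorem abs_le_of_simplexForm_nonneg {a : Fin (m + 1) → ℝ} (hs : 0 ≤ ∑ i, a i)
    (hq : 0 ≤ simplexForm a) (j : Fin (m + 1)) : |a j| ≤ ∑ i, a i := by
  refine abs_le_of_sq_le_sq ?_ hs
  have h1 : a j ^ 2 ≤ ∑ i, a i ^ 2 :=
    Finset.single_le_sum (f := fun i => a i ^ 2) (fun i _ => sq_nonneg _) (Finset.mem_univ j)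
  rw [simplexForm] at hq
  linarith

theorem sum_shiftMap_nonneg (hm : 1 ≤ m) {a : Fin (m + 1) → ℝ} (hs : 0 ≤ ∑ i, a i)
    (hq : 0 ≤ simplexForm a) : 0 ≤ ∑ i, shiftMap m a i := by
  have hm1 : (1 : ℝ) ≤ m := by exact_mod_cast hm
  have h1 : |a (Fin.last m) / m| ≤ ∑ i, a i := by
    rw [abs_div, Nat.abs_cast]
    exact (div_le_self (abs_nonneg _) hm1).trans (abs_le_of_simplexForm_nonneg hs hq _)
  rw [sum_shiftMap hm]
  linarith [(abs_le.1 h1).1]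

/-- The last coordinates along an orbit of `shiftMap` determine its starting point: as long as they
vanish, the map merely shifts the coordinates. -/
theorem eq_zero_of_shiftMap_pow_last (a : Fin (m + 1) → ℝ)
    (h : ∀ j ≤ m, (shiftMap m ^ j) a (Fin.last m) = 0) : a = 0 := by
  have key : ∀ j ≤ m, ∀ i : ℕ, ∀ hi : i + j < m + 1,
      (shiftMap m ^ j) a ⟨i + j, hi⟩ = a ⟨i, by omega⟩ := by
    intro j
    induction j with
    | zero => intro _ i hi; rfl
    | succ j ih =>
      intro hj i hi
      have h1 : (⟨i + (j + 1), hi⟩ : Fin (m + 1)) = Fin.succ ⟨i + j, by omega⟩ := rfl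
      rw [h1, pow_succ', Module.End.mul_apply, shiftMap_apply_succ, h j (by omega), zero_div,
        add_zero]
      exact ih (by omega) i (by omega)
  ext i
  have h1 := key (m - i) (by omega) i (by omega)
  have h2 : (⟨i + (m - i), by omega⟩ : Fin (m + 1)) = Fin.last m :=
    Fin.ext (by simp only [Fin.val_last]; omega)
  rw [h2, h _ (by omega)] at h1
  exact h1.symm

theorem simplexForm_shiftMap_pow_pos (hm : 1 ≤ m) {a : Fin (m + 1) → ℝ} (ha : a ≠ 0)
    (hq : 0 ≤ simplexForm a) : 0 < simplexForm ((shiftMap m ^ (m + 1)) a) := by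
  obtain ⟨j, hj, hne⟩ : ∃ j ≤ m, (shiftMap m ^ j) a (Fin.last m) ≠ 0 := by
    by_contra! h
    exact ha (eq_zero_of_shiftMap_pow_last a h)
  obtain ⟨i, rfl⟩ := Nat.exists_eq_add_of_le' hj
  have h1 := simplexForm_le_shiftMap_pow hm a j
  have h2 := simplexForm_le_shiftMap_pow hm ((shiftMap (i + j) ^ (j + 1)) a) i
  rw [← Module.End.mul_apply, ← pow_add, pow_succ' _ j, Module.End.mul_apply,
    simplexForm_shiftMap hm] at h2
  have h3 : 0 < (((i + j : ℕ) : ℝ) + 1) / (i + j : ℕ)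
      * (shiftMap (i + j) ^ j) a (Fin.last (i + j)) ^ 2 := by
    have : (0 : ℝ) < (i + j : ℕ) := by exact_mod_cast hm
    positivity
  change 0 < simplexForm ((shiftMap (i + j) ^ (i + (j + 1))) a)
  linarith

theorem shiftMap_pow_single_zero (j : ℕ) (hj : j < m + 1) :
    (shiftMap m ^ j) (Pi.single 0 1) = Pi.single ⟨j, hj⟩ 1 := by
  induction j with
  | zero => rfl
  | succ j ih =>
    rw [pow_succ', Module.End.mul_apply, ih (by omega)]
    have h0 : (⟨j, by omega⟩ : Fin (m + 1)) = Fin.castSucc ⟨j, by omega⟩ := rfl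
    have h1 : (⟨j + 1, hj⟩ : Fin (m + 1)) = Fin.succ ⟨j, by omega⟩ := rfl
    have h2 : (Pi.single (Fin.castSucc ⟨j, by omega⟩) 1 : Fin (m + 1) → ℝ) (Fin.last m) = 0 :=
      Pi.single_eq_of_ne (Fin.castSucc_lt_last _).ne' _
    ext i
    rw [h0, h1]
    refine Fin.cases ?_ (fun i => ?_) i
    · rw [shiftMap_apply_zero, h2, zero_div, Pi.single_eq_of_ne (Fin.succ_ne_zero _).symm]
    · rw [shiftMap_apply_succ, h2, zero_div, add_zero]
      simp only [Pi.single_apply, Fin.succ_inj, Fin.castSucc_inj]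

theorem simplexForm_single (j : Fin (m + 1)) : simplexForm (Pi.single j 1) = 0 := by
  simp [simplexForm, Pi.single_apply]

/-- The cone `{∑ aᵢ ≥ (∑ aᵢ²)^(1/2)}` is mapped linearly onto the Lorentz cone by rotating the
diagonal to the last coordinate axis and rescaling that axis by `√m`. -/
theorem exists_linearEquiv_lorentzForm_eq (hm : 1 ≤ m) :
    ∃ (e : (Fin (m + 1) → ℝ) ≃ₗ[ℝ] EuclideanSpace ℝ (Fin (m + 1))) (c : ℝ), 0 < c ∧
      ∀ a, e a (Fin.last m) = c * ∑ i, a i ∧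
        lorentzForm (Fin.last m) (e a) (e a) = simplexForm a := by
  have hm0 : (0 : ℝ) < m := by exact_mod_cast hm
  have hs : 0 < √((m : ℝ) + 1) := Real.sqrt_pos.2 (by positivity)
  have hs2 : √((m : ℝ) + 1) ^ 2 = m + 1 := Real.sq_sqrt (by positivity)
  let u : EuclideanSpace ℝ (Fin (m + 1)) := WithLp.toLp 2 fun _ => (√((m : ℝ) + 1))⁻¹
  have hu : ‖u‖ = 1 := by
    rw [← sq_eq_sq₀ (norm_nonneg _) zero_le_one, EuclideanSpace.real_norm_sq_eq]
    simp only [u, inv_pow, hs2, Finset.sum_const, Finset.card_univ, Fintype.card_fin, nsmul_eq_mul]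
    push_cast
    field_simp
  obtain ⟨b, hb⟩ := Orthonormal.exists_orthonormalBasis_extension_of_card_eq (𝕜 := ℝ)
    (ι := Fin (m + 1)) (E := EuclideanSpace ℝ (Fin (m + 1))) (by simp) (v := fun _ => u)
    (s := {Fin.last m})
    ⟨fun _ => hu, fun i j hij => (hij (Subsingleton.elim i j)).elim⟩
  have hb' : b (Fin.last m) = u := hb _ rfl
  let w : Fin (m + 1) → ℝ := Function.update (fun _ => 1) (Fin.last m) √(m : ℝ)
  have hwl : w (Fin.last m) = √(m : ℝ) := Function.update_self ..
  have hwc : ∀ i : Fin m, w i.castSucc = 1 := fun i =>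
    Function.update_of_ne (Fin.castSucc_lt_last i).ne _ _
  have hw : ∀ i, w i ≠ 0 := by
    refine Fin.lastCases ?_ fun i => ?_
    · rw [hwl]
      exact (Real.sqrt_pos.2 hm0).ne'
    · rw [hwc]
      exact one_ne_zero
  let e : (Fin (m + 1) → ℝ) ≃ₗ[ℝ] EuclideanSpace ℝ (Fin (m + 1)) :=
    (WithLp.linearEquiv 2 ℝ (Fin (m + 1) → ℝ)).symm ≪≫ₗ b.repr.toLinearEquiv ≪≫ₗ
      WithLp.linearEquiv 2 ℝ (Fin (m + 1) → ℝ) ≪≫ₗ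
      LinearEquiv.piCongrRight (fun i => LinearEquiv.smulOfNeZero ℝ ℝ (w i) (hw i)) ≪≫ₗ
      (WithLp.linearEquiv 2 ℝ (Fin (m + 1) → ℝ)).symm
  have he : ∀ a i, e a i = w i * b.repr (WithLp.toLp 2 a) i := fun a i => rfl
  have hlast : ∀ a : Fin (m + 1) → ℝ,
      b.repr (WithLp.toLp 2 a) (Fin.last m) = (√((m : ℝ) + 1))⁻¹ * ∑ i, a i := by
    intro a
    rw [b.repr_apply_apply, hb', Finset.mul_sum]
    simp [u, PiLp.inner_apply, mul_comm]
  refine ⟨e, √(m : ℝ) * (√((m : ℝ) + 1))⁻¹, by positivity, fun a => ⟨?_, ?_⟩⟩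
  · rw [he, hwl, hlast, mul_assoc]
  · have hn : ∑ i, a i ^ 2 = ‖b.repr (WithLp.toLp 2 a)‖ ^ 2 := by
      rw [b.repr.norm_map, EuclideanSpace.real_norm_sq_eq]
    have he2 : ‖e a‖ ^ 2 = ∑ i, (e a i) ^ 2 := EuclideanSpace.real_norm_sq_eq _
    rw [simplexForm, hn, lorentzForm_self, he2, EuclideanSpace.real_norm_sq_eq,
      Fin.sum_univ_castSucc fun i => e a i ^ 2,
      Fin.sum_univ_castSucc fun i => b.repr (WithLp.toLp 2 a) i ^ 2]
    simp only [he, hwl, hwc, hlast, mul_pow, inv_pow, hs2, Real.sq_sqrt hm0.le, one_mul]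
    field_simp
    ring

theorem exists_isPrimitiveMap_primitivityIndex_eq_succ (hm : 1 ≤ m) :
    ∃ Ψ : EuclideanSpace ℝ (Fin (m + 1)) →ₗ[ℝ] EuclideanSpace ℝ (Fin (m + 1)),
      IsPrimitiveMap (lorentzCone (m + 1) (Nat.le_add_left 1 m)) Ψ ∧
        primitivityIndex (lorentzCone (m + 1) (Nat.le_add_left 1 m)) Ψ = m + 1 := by
  obtain ⟨e, c, hc, he⟩ := exists_linearEquiv_lorentzForm_eq hm
  have hmem : ∀ a, e a ∈ lorentzCone (m + 1) (Nat.le_add_left 1 m) ↔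
      0 ≤ ∑ i, a i ∧ 0 ≤ simplexForm a := by
    intro a
    rw [mem_lorentzCone_iff, ← (he a).2]
    change 0 ≤ e a (Fin.last m) ∧ _ ↔ _
    rw [(he a).1, mul_nonneg_iff_of_pos_left hc]
    rfl
  have hint : ∀ a, e a ∈ interior (lorentzCone (m + 1) (Nat.le_add_left 1 m)) ↔
      e a ∈ lorentzCone (m + 1) (Nat.le_add_left 1 m) ∧ 0 < simplexForm a := by
    intro a
    rw [mem_interior_lorentzCone_iff, ← (he a).2]
    rfl
  have hpow : ∀ k a, (e.conj (shiftMap m) ^ k) (e a) = e ((shiftMap m ^ k) a) := by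
    intro k a
    induction k with
    | zero => rfl
    | succ k ih =>
      rw [pow_succ', pow_succ', Module.End.mul_apply, Module.End.mul_apply, ih,
        LinearEquiv.conj_apply_apply, e.symm_apply_apply]
  have hpos : IsPositiveMap (lorentzCone (m + 1) (Nat.le_add_left 1 m)) (e.conj (shiftMap m)) := by
    intro x hx
    obtain ⟨a, rfl⟩ := e.surjective x
    obtain ⟨h1, h2⟩ := (hmem a).1 hx
    have h3 := hpow 1 a
    rw [pow_one, pow_one] at h3
    rw [h3, hmem]
    have h4 := simplexForm_le_shiftMap_pow hm a 1
    exact ⟨sum_shiftMap_nonneg hm h1 h2, h2.trans h4⟩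
  have hprim : IsPrimitiveMap (lorentzCone (m + 1) (Nat.le_add_left 1 m))
      (e.conj (shiftMap m)) := by
    refine ⟨hpos, m + 1, Nat.le_add_left 1 m, ?_⟩
    rintro x ⟨hx, hx0⟩
    obtain ⟨a, rfl⟩ := e.surjective x
    have h1 := hpos.pow (m + 1) hx
    rw [hpow] at h1 ⊢
    refine (hint _).2 ⟨h1, simplexForm_shiftMap_pow_pos hm ?_ ((hmem a).1 hx).2⟩
    rintro rfl
    exact hx0 (map_zero e)
  refine ⟨_, hprim, le_antisymm (primitivityIndex_le hprim) ?_⟩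
  -- The orbit of the null vector `e₀` consists of the null vectors `e₁, …, eₘ` up to step `m`.
  refine le_csInf hprim.2 fun k hk => ?_
  by_contra! hlt
  have h0 : e (Pi.single 0 1) ∈ lorentzCone (m + 1) (Nat.le_add_left 1 m) := by
    rw [hmem, simplexForm_single]
    simp
  have h1 := hk.2 ⟨h0, by simp⟩
  rw [hpow, hint, shiftMap_pow_single_zero k hlt, simplexForm_single] at h1
  exact lt_irrefl _ h1.2

end Extremal

theorem exists_isPrimitiveMap_primitivityIndex_eq (n : ℕ) (hn : 1 ≤ n) :
    ∃ Ψ : EuclideanSpace ℝ (Fin n) →ₗ[ℝ] EuclideanSpace ℝ (Fin n),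
      IsPrimitiveMap (lorentzCone n hn) Ψ ∧ primitivityIndex (lorentzCone n hn) Ψ = n := by
  obtain ⟨m, rfl⟩ : ∃ m, n = m + 1 := ⟨n - 1, by omega⟩
  rcases Nat.eq_zero_or_pos m with rfl | hm
  · -- On the half-line the identity is already strictly positive.
    have hprim : IsPrimitiveMap (lorentzCone (0 + 1) hn) LinearMap.id := by
      refine ⟨fun x hx => hx, 1, le_rfl, ?_⟩
      rintro x ⟨hx, hx0⟩
      rw [pow_one, LinearMap.id_apply, mem_interior_lorentzCone_iff]
      refine ⟨hx, ?_⟩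
      have h1 : ‖x‖ ^ 2 = x 0 ^ 2 := by
        rw [EuclideanSpace.real_norm_sq_eq]
        exact Fin.sum_univ_one _
      have h2 : 0 < ‖x‖ := norm_pos_iff.2 hx0
      rw [lorentzForm_self]
      change 0 < 2 * x.ofLp 0 ^ 2 - ‖x‖ ^ 2
      rw [← h1]
      linarith [pow_pos h2 2]
    exact ⟨_, hprim, le_antisymm (primitivityIndex_le hprim) (Nat.sInf_mem hprim.2).1⟩
  · exact exists_isPrimitiveMap_primitivityIndex_eq_succ hm

theorem theorem1 (n : ℕ) (hn : 1 ≤ n) :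
    (∀ Ψ : EuclideanSpace ℝ (Fin n) →ₗ[ℝ] EuclideanSpace ℝ (Fin n),
      IsPrimitiveMap (lorentzCone n hn) Ψ →
        primitivityIndex (lorentzCone n hn) Ψ ≤ n) ∧
    (∃ Ψ : EuclideanSpace ℝ (Fin n) →ₗ[ℝ] EuclideanSpace ℝ (Fin n),
      IsPrimitiveMap (lorentzCone n hn) Ψ ∧
        primitivityIndex (lorentzCone n hn) Ψ = n) ∧
    maximalExponent (lorentzCone n hn) = (n : ℕ∞) := by
  obtain ⟨Φ, hΦ, hind⟩ := exists_isPrimitiveMap_primitivityIndex_eq n hn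
  refine ⟨fun Ψ hΨ => primitivityIndex_le hΨ, ⟨Φ, hΦ, hind⟩, le_antisymm ?_ ?_⟩
  · exact iSup₂_le fun Ψ hΨ => Nat.cast_le.2 (primitivityIndex_le hΨ)
  · calc (n : ℕ∞) = (primitivityIndex (lorentzCone n hn) Φ : ℕ∞) := by rw [hind]
      _ ≤ _ := le_iSup₂ (f := fun (Ψ : EuclideanSpace ℝ (Fin n) →ₗ[ℝ] EuclideanSpace ℝ (Fin n))
          (_ : IsPrimitiveMap (lorentzCone n hn) Ψ) =>
            (primitivityIndex (lorentzCone n hn) Ψ : ℕ∞)) Φ hΦ
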